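/- Let $G$ be a compact (Hausdorff topological) group, for example a compact Lie group, or a finite group with the discrete topology. Let $\mathcal H_{\rm in}$ and $\mathcal H_{\rm out}$ be complex Hilbert spaces carrying strongly continuous unitary representations $U_{\rm in}$ and $U_{\rm out}$ of $G$, and let $\psi\in\mathcal H_{\rm in}$ and $\phi\in\mathcal H_{\rm out}$ be unit vectors, with characteristic functions $\chi_\psi(g)=\langle\psi|U_{\rm in}(g)|\psi\rangle$ and $\chi_\phi(g)=\langle\phi|U_{\rm out}(g)|\phi\rangle$. A quantum channel is a linear, completely positive, trace-preserving map $\mathcal E$ from the trace-class operators on $\mathcal H_{\rm in}$ to those on $\mathcal H_{\rm out}$; it is $G$-covariant if $\mathcal E(U_{\rm in}(g)\,X\,U_{\rm in}(g)^\dagger)=U_{\rm out}(g)\,\mathcal E(X)\,U_{\rm out}(g)^\dagger$ for all $g\in G$ and all trace-class $X$. Then the following are equivalent: 1. there is a $G$-covariant quantum channel $\mathcal E$ with $\mathcal E(|\psi\rangle\langle\psi|)=|\phi\rangle\langle\phi|$; 2. there is a positive definite function $f:G\to\mathbb C$ (that is, for all $n\in\mathbb N$ and $g_1,\dots,g_n\in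 G$ the matrix $\big(f(g_i^{-1}g_j)\big)_{i,j}$ is positive semidefinite) such that $\chi_\psi(g)=\chi_\phi(g)\,f(g)$ for all $g\in G$. -/

import Mathlib

open scoped ComplexOrder InnerProductSpace

set_option linter.unusedSectionVars false

noncomputable section

namespace CovariantConversion

/-! ### Trace-class operators and the trace -/

section TraceClass

variable (H : Type*) [NormedAddCommGroup H] [InnerProductSpace ℂ H] [CompleteSpace H]

/-- Index set of a fixed orthonormal (Hilbert) basis of `H`. -/
def basisIndex : Set H := (exists_hilbertBasis ℂ H).choose

/-- A fixed orthonormal basis of `H`. The notions below do not depend on it: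
see `hasSum_trace`. -/
def onb : HilbertBasis (basisIndex H) ℂ H := (exists_hilbertBasis ℂ H).choose_spec.choose

/-- Positive bounded operators with finite trace. -/
def positiveTraceClass : Set (H →L[ℂ] H) :=
  {T | T.IsPositive ∧ Summable fun i => (⟪onb H i, T (onb H i)⟫_ℂ).re}

/-- The trace-class operators on `H`: the complex linear span of the positive bounded operators
with finite trace. -/
def traceClass : Submodule ℂ (H →L[ℂ] H) := Submodule.span ℂ (positiveTraceClass H)

variable {H}

/-- The trace `∑ᵢ ⟨eᵢ, T eᵢ⟩` of a trace-class operator. -/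
def trace (T : traceClass H) : ℂ := ∑' i, ⟪onb H i, T.1 (onb H i)⟫_ℂ

theorem tsum_enorm_sq {ι : Type*} (c : HilbertBasis ι ℂ H) (x : H) :
    ∑' k, ENNReal.ofReal (‖⟪c k, x⟫_ℂ‖ ^ 2) = ENNReal.ofReal (‖x‖ ^ 2) := by
  have h := (c.hasSum_inner_mul_inner x x).mapL Complex.reCLM
  have h2 : HasSum (fun k => ‖⟪c k, x⟫_ℂ‖ ^ 2) (‖x‖ ^ 2) := by
    convert h using 1
    · funext k
      rw [← inner_conj_symm x (c k)]
      simp [← Complex.normSq_eq_conj_mul_self, Complex.normSq_eq_norm_sq, -inner_conj_symm]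
      norm_cast
    · simp [inner_self_eq_norm_sq_to_K, ← Complex.ofReal_pow]
  rw [← h2.tsum_eq, ENNReal.ofReal_tsum_of_nonneg (fun _ => by positivity) h2.summable]

theorem tsum_norm_sq_swap {ι κ : Type*} (b : HilbertBasis ι ℂ H) (c : HilbertBasis κ ℂ H)
    (S : H →L[ℂ] H) :
    ∑' i, ENNReal.ofReal (‖S (b i)‖ ^ 2) =
      ∑' k, ENNReal.ofReal (‖ContinuousLinearMap.adjoint S (c k)‖ ^ 2) := by
  simp_rw [← tsum_enorm_sq c (S _), ← tsum_enorm_sq b (ContinuousLinearMap.adjoint S _)]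
  rw [ENNReal.tsum_comm]
  refine tsum_congr fun k => tsum_congr fun i => ?_
  rw [ContinuousLinearMap.adjoint_inner_right, norm_inner_symm]

theorem tsum_trace_eq {ι κ : Type*} (b : HilbertBasis ι ℂ H) (c : HilbertBasis κ ℂ H)
    {T : H →L[ℂ] H} (hT : T.IsPositive) :
    ∑' i, ENNReal.ofReal (⟪b i, T (b i)⟫_ℂ).re = ∑' k, ENNReal.ofReal (⟪c k, T (c k)⟫_ℂ).re := by
  have hn : 0 ≤ T := (ContinuousLinearMap.nonneg_iff_isPositive T).2 hT
  have hS : IsSelfAdjoint (CFC.sqrt T) := IsSelfAdjoint.of_nonneg (CFC.sqrt_nonneg T)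
  have hadj : ContinuousLinearMap.adjoint (CFC.sqrt T) = CFC.sqrt T := hS
  have key : ∀ x : H, (⟪x, T x⟫_ℂ).re = ‖CFC.sqrt T x‖ ^ 2 := by
    intro x
    conv_lhs => rw [← CFC.sqrt_mul_sqrt_self T hn]
    rw [mul_apply_eq_comp, ← ContinuousLinearMap.adjoint_inner_left, hadj]
    simp [inner_self_eq_norm_sq_to_K, ← Complex.ofReal_pow]
  simp_rw [key]
  rw [tsum_norm_sq_swap b c, hadj]

theorem re_inner_nonneg {T : H →L[ℂ] H} (hT : T.IsPositive) (x : H) :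
    0 ≤ (⟪x, T x⟫_ℂ).re := hT.re_inner_nonneg_right x

theorem summable_of_mem {κ : Type*} (c : HilbertBasis κ ℂ H) {T : H →L[ℂ] H}
    (hT : T ∈ positiveTraceClass H) : Summable fun k => (⟪c k, T (c k)⟫_ℂ).re := by
  have h := hT.2.tsum_ofReal_ne_top
  rw [tsum_trace_eq (onb H) c hT.1] at h
  have := ENNReal.summable_toReal h
  simpa [ENNReal.toReal_ofReal (re_inner_nonneg hT.1 _)] using this

/-- The diagonal series of a trace-class operator converges in every orthonormal basis, and its
sum is the trace. -/
theorem hasSum_trace {κ : Type*} (c : HilbertBasis κ ℂ H) (T : traceClass H) :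
    HasSum (fun k => ⟪c k, T.1 (c k)⟫_ℂ) (trace T) := by
  suffices h : ∀ T ∈ traceClass H, ∃ t : ℂ, HasSum (fun i => ⟪onb H i, T (onb H i)⟫_ℂ) t ∧
      HasSum (fun k => ⟪c k, T (c k)⟫_ℂ) t by
    obtain ⟨t, h1, h2⟩ := h T.1 T.2
    rw [trace, h1.tsum_eq]
    exact h2
  intro T hT
  induction hT using Submodule.span_induction with
  | mem T hT =>
    have hre : ∀ x : H, ((⟪x, T x⟫_ℂ).re : ℂ) = ⟪x, T x⟫_ℂ := fun x =>
      (Complex.eq_re_of_ofReal_le (hT.1.inner_nonneg_right x)).symm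
    have e : ∑' i, (⟪onb H i, T (onb H i)⟫_ℂ).re = ∑' k, (⟪c k, T (c k)⟫_ℂ).re := by
      have h := tsum_trace_eq (onb H) c hT.1
      rw [← ENNReal.ofReal_tsum_of_nonneg (fun _ => re_inner_nonneg hT.1 _) hT.2,
        ← ENNReal.ofReal_tsum_of_nonneg (fun _ => re_inner_nonneg hT.1 _)
          (summable_of_mem c hT)] at h
      exact (ENNReal.ofReal_eq_ofReal_iff (tsum_nonneg fun _ => re_inner_nonneg hT.1 _)
        (tsum_nonneg fun _ => re_inner_nonneg hT.1 _)).1 h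
    refine ⟨((∑' i, (⟪onb H i, T (onb H i)⟫_ℂ).re : ℝ) : ℂ), ?_, ?_⟩
    · simpa only [hre] using Complex.hasSum_ofReal.2 hT.2.hasSum
    · rw [e]
      simpa only [hre] using Complex.hasSum_ofReal.2 (summable_of_mem c hT).hasSum
  | zero => exact ⟨0, by simp [hasSum_zero], by simp [hasSum_zero]⟩
  | add S T _ _ hS hT =>
    obtain ⟨s, hs1, hs2⟩ := hS
    obtain ⟨t, ht1, ht2⟩ := hT
    exact ⟨s + t, by simpa [inner_add_right] using hs1.add ht1,
      by simpa [inner_add_right] using hs2.add ht2⟩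
  | smul a T _ hT =>
    obtain ⟨t, ht1, ht2⟩ := hT
    exact ⟨a * t, by simpa [inner_smul_right] using ht1.mul_left a,
      by simpa [inner_smul_right] using ht2.mul_left a⟩

/-- The rank-one operator `|ψ⟩⟨ψ|` is trace class. -/
theorem rankOne_mem (ψ : H) : InnerProductSpace.rankOne ℂ ψ ψ ∈ traceClass H := by
  refine Submodule.subset_span ⟨InnerProductSpace.isPositive_rankOne_self ψ, ?_⟩
  have h := ((onb H).hasSum_inner_mul_inner ψ ψ).mapL Complex.reCLM
  simpa [inner_smul_right, mul_comm] using h.summable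

/-- The operator `|ψ⟩⟨ψ|`; for a unit vector `ψ` this is the density operator of the
pure state `ψ`. -/
def pureState (ψ : H) : traceClass H := ⟨InnerProductSpace.rankOne ℂ ψ ψ, rankOne_mem ψ⟩

theorem unitary_conj_mem (u : unitary (H →L[ℂ] H)) {T : H →L[ℂ] H} (hT : T ∈ traceClass H) :
    (u : H →L[ℂ] H) * T * star (u : H →L[ℂ] H) ∈ traceClass H := by
  induction hT using Submodule.span_induction with
  | mem T hT =>
    refine Submodule.subset_span ⟨?_, ?_⟩
    · exact hT.1.conj_adjoint (u : H →L[ℂ] H)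
    · let e : H ≃ₗᵢ[ℂ] H := Unitary.linearIsometryEquiv u
      let c : HilbertBasis (basisIndex H) ℂ H := ⟨e.trans (onb H).repr⟩
      have hc : ∀ i, c i = star (u : H →L[ℂ] H) (onb H i) := by
        intro i
        rfl
      have := summable_of_mem c hT
      simp_rw [hc] at this
      convert this using 3 with i
      rw [mul_apply_eq_comp, mul_apply_eq_comp,
        ← ContinuousLinearMap.adjoint_inner_left]
      rfl
  | zero => simp
  | add S T _ _ hS hT => simpa [mul_add, add_mul] using add_mem hS hT
  | smul a T _ hT => simpa using Submodule.smul_mem _ a hT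

/-- Conjugation `T ↦ u T u†` of a trace-class operator by a unitary operator. -/
def conj (u : unitary (H →L[ℂ] H)) (T : traceClass H) : traceClass H :=
  ⟨(u : H →L[ℂ] H) * T.1 * star (u : H →L[ℂ] H), unitary_conj_mem u T.2⟩

end TraceClass

/-! ### Quantum channels -/

section Channel

variable {H K : Type*} [NormedAddCommGroup H] [InnerProductSpace ℂ H] [CompleteSpace H]
  [NormedAddCommGroup K] [InnerProductSpace ℂ K] [CompleteSpace K]

/-- An `n × n` matrix of trace-class operators on `H` is positive, as an operator on the `n`-fold
direct sum of `H`. -/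
def BlockPositive {n : ℕ} (A : Matrix (Fin n) (Fin n) (traceClass H)) : Prop :=
  ∀ x : Fin n → H, 0 ≤ ∑ i, ∑ j, ⟪x i, (A i j).1 (x j)⟫_ℂ

/-- A linear map between spaces of trace-class operators is completely positive if for every `n`
its entrywise application preserves positivity of `n × n` operator matrices. -/
def IsCompletelyPositive (E : traceClass H →ₗ[ℂ] traceClass K) : Prop :=
  ∀ (n : ℕ) (A : Matrix (Fin n) (Fin n) (traceClass H)), BlockPositive A → BlockPositive (A.map E)

/-- A quantum channel: linear, completely positive and trace preserving. -/
def IsQuantumChannel (E : traceClass H →ₗ[ℂ] traceClass K) : Prop :=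
  IsCompletelyPositive E ∧ ∀ T, trace (E T) = trace T

end Channel

/-! ### Symmetry -/

section Symmetry

/-- A (strongly continuous) unitary representation of a topological group on a Hilbert space. -/
structure UnitaryRep (G : Type*) [Group G] [TopologicalSpace G] (H : Type*)
    [NormedAddCommGroup H] [InnerProductSpace ℂ H] [CompleteSpace H] where
  toHom : G →* unitary (H →L[ℂ] H)
  continuous_apply : ∀ x : H, Continuous fun g => (toHom g : H →L[ℂ] H) x

variable {G : Type*} [Group G] [TopologicalSpace G]
  {H K : Type*} [NormedAddCommGroup H] [InnerProductSpace ℂ H] [CompleteSpace H]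
  [NormedAddCommGroup K] [InnerProductSpace ℂ K] [CompleteSpace K]

/-- `E (U(g) T U(g)†) = V(g) E(T) V(g)†` for all `g` and `T`. -/
def IsCovariant (U : UnitaryRep G H) (V : UnitaryRep G K)
    (E : traceClass H →ₗ[ℂ] traceClass K) : Prop :=
  ∀ (g : G) (T : traceClass H), E (conj (U.toHom g) T) = conj (V.toHom g) (E T)

/-- The state `ρ` evolves to `σ` under some `G`-covariant quantum channel. -/
def CovariantlyConvertible (U : UnitaryRep G H) (V : UnitaryRep G K)
    (ρ : traceClass H) (σ : traceClass K) : Prop :=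
  ∃ E : traceClass H →ₗ[ℂ] traceClass K, IsQuantumChannel E ∧ IsCovariant U V E ∧ E ρ = σ

/-- The characteristic function `χ_ψ(g) = ⟨ψ, U(g) ψ⟩`. -/
def charFn (U : UnitaryRep G H) (ψ : H) (g : G) : ℂ := ⟪ψ, (U.toHom g : H →L[ℂ] H) ψ⟫_ℂ

/-- A function on a group is positive definite if all matrices `(f (gᵢ⁻¹ gⱼ))ᵢⱼ` are
positive semidefinite. -/
def IsPositiveDefinite {G : Type*} [Group G] (f : G → ℂ) : Prop :=
  ∀ (n : ℕ) (g : Fin n → G), (Matrix.of fun i j => f ((g i)⁻¹ * g j)).PosSemidef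

end Symmetry

end CovariantConversion

end

open scoped ComplexOrder InnerProductSpace

set_option linter.unusedSectionVars false

noncomputable section

namespace CovariantConversion

open InnerProductSpace ContinuousLinearMap

/-! ### From a covariant channel to a positive definite function -/

section Forward

variable {H K : Type*} [NormedAddCommGroup H] [InnerProductSpace ℂ H] [CompleteSpace H]
  [NormedAddCommGroup K] [InnerProductSpace ℂ K] [CompleteSpace K]

/-! Write `a g = U(g)ψ` and `b g = V(g)φ` for the two orbits. Their Gram matrices have entries
`χ_ψ(g⁻¹h)` and `χ_φ(g⁻¹h)`, so the theorem says that a covariant channel exists exactly when the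
first Gram kernel is the entrywise product of the second with an invariant positive semidefinite
kernel.

Given a channel `E`, covariance yields `E(|a g⟩⟨a g|) = |b g⟩⟨b g|`. By complete positivity the
blocks `E(|a gᵢ⟩⟨a gⱼ|)` form a positive operator matrix, and pure diagonal blocks force `E(|a g⟩⟨a
h|) = c(g,h) |b g⟩⟨b h|` (`BlockPositive.eq_smul_rankOne`). The kernel `c` is positive semidefinite,
left invariant by covariance, and trace preservation turns this identity into the factorization,
with `f(g) = c(g,1)`.

Given `f`, a reproducing kernel space supplies features with `f(g⁻¹h) = ∑ⱼ conj(mⱼ(g)) mⱼ(h)`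
(`IsPositiveDefinite.exists_features`). The vectors `(mⱼ(g) V(g)φ)ⱼ` in `ℓ²(J, K)` have the Gram
matrix of the orbit of `ψ`, so a partial isometry carries one family to the other
(`exists_partialIsometry`). Its components are Kraus operators of a covariant map on the closed span
of that orbit (`exists_cyclic_kraus`). The orthogonal complement is sent to a `V`-invariant state,
the Haar average of the orbit of `φ` (`exists_invariant_state`); this is where compactness enters.
No continuity of `f` is needed. -/

/-- Polarization reduces the claim to four positive rank-one operators. -/
theorem rankOne_mem_traceClass (x y : H) : rankOne ℂ x y ∈ traceClass H := by
  have h : rankOne ℂ x y = (1 / 4 : ℂ) • (rankOne ℂ (x + y) (x + y) - rankOne ℂ (x - y) (x - y) +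
      Complex.I • rankOne ℂ (x + Complex.I • y) (x + Complex.I • y) -
      Complex.I • rankOne ℂ (x - Complex.I • y) (x - Complex.I • y)) := by
    ext z
    simp only [rankOne_apply, smul_apply, sub_apply, add_apply, inner_add_left, inner_sub_left,
      inner_smul_left, Complex.conj_I]
    match_scalars <;> ring_nf <;> simp only [Complex.I_sq] <;> ring
  rw [h]
  refine Submodule.smul_mem _ _ (sub_mem (add_mem (sub_mem (rankOne_mem _) (rankOne_mem _)) ?_) ?_)
  · exact Submodule.smul_mem _ _ (rankOne_mem _)
  · exact Submodule.smul_mem _ _ (rankOne_mem _)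

/-- The trace-class operator `|x⟩⟨y|`. -/
def ketBra (x y : H) : traceClass H := ⟨rankOne ℂ x y, rankOne_mem_traceClass x y⟩

theorem ketBra_self (x : H) : ketBra x x = pureState x := rfl

theorem ketBra_apply (x y z : H) : (ketBra x y).1 z = ⟪y, z⟫_ℂ • x := rfl

theorem trace_smul_ketBra (T : traceClass H) (c : ℂ) (x y : H) (hT : T.1 = c • rankOne ℂ x y) :
    trace T = c * ⟪y, x⟫_ℂ := by
  have h := hasSum_trace (onb H) T
  refine h.unique ?_
  have e : ∀ k, ⟪onb H k, T.1 (onb H k)⟫_ℂ = c * (⟪y, onb H k⟫_ℂ * ⟪onb H k, x⟫_ℂ) := fun k => by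
    rw [hT, smul_apply, rankOne_apply, inner_smul_right, inner_smul_right]
  simpa only [e] using ((onb H).hasSum_inner_mul_inner y x).mul_left c

theorem conj_ketBra (u : unitary (H →L[ℂ] H)) (x y : H) :
    conj u (ketBra x y) = ketBra ((u : H →L[ℂ] H) x) ((u : H →L[ℂ] H) y) := by
  ext z
  change (u : H →L[ℂ] H) (⟪y, star (u : H →L[ℂ] H) z⟫_ℂ • x) = _
  rw [map_smul, star_eq_adjoint, adjoint_inner_right]
  rfl

theorem inner_unitary_apply (u : unitary (H →L[ℂ] H)) (x y : H) :
    ⟪(u : H →L[ℂ] H) x, (u : H →L[ℂ] H) y⟫_ℂ = ⟪x, y⟫_ℂ := by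
  rw [← adjoint_inner_right, ← star_eq_adjoint]
  change ⟪x, (star (u : H →L[ℂ] H) * (u : H →L[ℂ] H)) y⟫_ℂ = _
  rw [Unitary.coe_star_mul_self]
  rfl

theorem unitary_inner_right (u : unitary (H →L[ℂ] H)) (x y : H) :
    ⟪x, (u : H →L[ℂ] H) y⟫_ℂ = ⟪star (u : H →L[ℂ] H) x, y⟫_ℂ := by
  rw [star_eq_adjoint, adjoint_inner_left]

theorem blockPositive_ketBra {n : ℕ} (a : Fin n → H) :
    BlockPositive (Matrix.of fun i j => ketBra (a i) (a j)) := by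
  intro x
  have h : ∑ i, ∑ j, ⟪x i, ((Matrix.of fun i j => ketBra (a i) (a j)) i j).1 (x j)⟫_ℂ =
      star (∑ i, ⟪a i, x i⟫_ℂ) * ∑ j, ⟪a j, x j⟫_ℂ := by
    simp only [Matrix.of_apply, ketBra_apply, inner_smul_right, star_sum, Finset.sum_mul_sum]
    refine Finset.sum_congr rfl fun i _ => Finset.sum_congr rfl fun j _ => ?_
    rw [Complex.star_def, inner_conj_symm, mul_comm]
  rw [h]
  exact star_mul_self_nonneg _

/-- In a positive operator matrix, a vector with vanishing diagonal form is annihilated by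
the off-diagonal form. -/
theorem BlockPositive.inner_eq_zero {n : ℕ} {A : Matrix (Fin n) (Fin n) (traceClass H)}
    (hA : BlockPositive A) {i j : Fin n} (hij : i ≠ j) {x : H} (y : H)
    (hx : ⟪x, (A i i).1 x⟫_ℂ = 0) : ⟪x, (A i j).1 y⟫_ℂ = 0 ∧ ⟪y, (A j i).1 x⟫_ℂ = 0 := by
  -- Test positivity on the vector with `c • x` in slot `i` and `y` in slot `j`. The term quadratic
  -- in `c` vanishes by `hx`, so a real-affine function of `c` is nonnegative everywhere and its
  -- linear part must be zero.
  have key : ∀ c : ℂ, 0 ≤ star c * ⟪x, (A i j).1 y⟫_ℂ + c * ⟪y, (A j i).1 x⟫_ℂ +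
      ⟪y, (A j j).1 y⟫_ℂ := by
    intro c
    have h := hA (Pi.single i (c • x) + Pi.single j y)
    have hs : ∀ F : Fin n → Fin n → ℂ, (∀ k l, (k ≠ i ∧ k ≠ j) ∨ (l ≠ i ∧ l ≠ j) → F k l = 0) →
        ∑ k, ∑ l, F k l = (F i i + F i j) + (F j i + F j j) := by
      intro F hF
      have hr : ∀ k, ∑ l, F k l = F k i + F k j := fun k => by
        rw [Fintype.sum_eq_add i j hij fun l hl => hF k l (Or.inr hl)]
      simp_rw [hr]
      rw [Fintype.sum_eq_add i j hij fun k hk => by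
        rw [hF k i (Or.inl hk), hF k j (Or.inl hk), add_zero]]
    rw [hs] at h
    · simp only [Pi.add_apply, Pi.single_eq_same, Pi.single_eq_of_ne hij,
        Pi.single_eq_of_ne hij.symm, add_zero, zero_add, inner_smul_left, inner_smul_right,
        map_smul, hx, mul_zero] at h
      rw [← add_assoc] at h
      exact h
    · rintro k l (⟨h1, h2⟩ | ⟨h1, h2⟩) <;>
        simp [Pi.single_eq_of_ne h1, Pi.single_eq_of_ne h2]
  generalize ⟪x, (A i j).1 y⟫_ℂ = p at key ⊢
  generalize ⟪y, (A j i).1 x⟫_ℂ = q at key ⊢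
  generalize ⟪y, (A j j).1 y⟫_ℂ = r at key ⊢
  have him : r.im = 0 := by simpa using (Complex.le_def.1 (key 0)).2.symm
  -- Real and purely imaginary `c` separate the real and imaginary parts of `p` and `q`.
  have h1 := fun t : ℝ => Complex.le_def.1 (key t)
  have h2 := fun t : ℝ => Complex.le_def.1 (key (t * Complex.I))
  simp [him] at h1 h2
  have hlin : ∀ s b : ℝ, (∀ t : ℝ, 0 ≤ t * s + b) → s = 0 := by
    intro s b h
    by_contra hs
    have := h ((-b - 1) / s)
    rw [div_mul_cancel₀ _ hs] at this
    linarith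
  have e1 := hlin (p.re + q.re) r.re fun t => by have := (h1 t).1; linarith
  have e2 := hlin (p.im - q.im) r.re fun t => by have := (h2 t).1; linarith
  have e3 := (h1 1).2
  have e4 := (h2 1).2
  constructor <;> apply Complex.ext <;> simp <;> linarith

/-- A block of a positive operator matrix whose diagonal blocks are pure states. -/
theorem BlockPositive.eq_smul_rankOne {n : ℕ} {A : Matrix (Fin n) (Fin n) (traceClass H)}
    (hA : BlockPositive A) {i j : Fin n} (hij : i ≠ j) {a b : H} (ha : ‖a‖ = 1) (hb : ‖b‖ = 1)
    (hi : A i i = pureState a) (hj : A j j = pureState b) :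
    (A i j).1 = ⟪a, (A i j).1 b⟫_ℂ • rankOne ℂ a b := by
  have haa : ⟪a, a⟫_ℂ = 1 := by simp [inner_self_eq_norm_sq_to_K, ha]
  have hbb : ⟪b, b⟫_ℂ = 1 := by simp [inner_self_eq_norm_sq_to_K, hb]
  -- The diagonal forms vanish on the complements of `a` and of `b`, so the block sees only the
  -- component of its left argument along `a` and of its right argument along `b`.
  have h1 : ∀ x y : H, ⟪a, x⟫_ℂ = 0 → ⟪x, (A i j).1 y⟫_ℂ = 0 := fun x y hx =>
    (hA.inner_eq_zero hij y (by
      rw [hi, ← ketBra_self, ketBra_apply, hx, zero_smul, inner_zero_right])).1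
  have h2 : ∀ x y : H, ⟪b, y⟫_ℂ = 0 → ⟪x, (A i j).1 y⟫_ℂ = 0 := fun x y hy =>
    (hA.inner_eq_zero hij.symm x (by
      rw [hj, ← ketBra_self, ketBra_apply, hy, zero_smul, inner_zero_right])).2
  ext y
  refine ext_inner_left ℂ fun x => ?_
  have e1 := h1 (x - ⟪a, x⟫_ℂ • a) y (by
    rw [inner_sub_right, inner_smul_right, haa, mul_one, sub_self])
  have e2 := h2 a (y - ⟪b, y⟫_ℂ • b) (by
    rw [inner_sub_right, inner_smul_right, hbb, mul_one, sub_self])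
  rw [inner_sub_left, inner_smul_left, inner_conj_symm, sub_eq_zero] at e1
  rw [map_sub, map_smul, inner_sub_right, inner_smul_right, sub_eq_zero] at e2
  rw [e1, e2]
  simp [inner_smul_right]
  ring

theorem posSemidef_of_forall_sum_nonneg {n : ℕ} {M : Matrix (Fin n) (Fin n) ℂ}
    (hM : ∀ z : Fin n → ℂ, 0 ≤ ∑ i, ∑ j, star (z i) * M i j * z j) : M.PosSemidef := by
  rw [← Matrix.isPositive_toEuclideanLin_iff, LinearMap.isPositive_iff_complex]
  intro x
  have h := hM x
  have e : ⟪M.toEuclideanLin x, x⟫_ℂ = star (∑ i, ∑ j, star (x i) * M i j * x j) := by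
    simp only [PiLp.inner_apply, Matrix.toLpLin_apply, Matrix.mulVec, dotProduct,
      RCLike.inner_apply, map_sum, map_mul, Finset.mul_sum, star_sum, star_mul',
      Complex.star_def, Complex.conj_conj]
    exact Finset.sum_congr rfl fun i _ => Finset.sum_congr rfl fun j _ => by ring
  rw [e, (IsSelfAdjoint.of_nonneg h).star_eq]
  exact ⟨(Complex.eq_re_of_ofReal_le h).symm, (Complex.le_def.1 h).1⟩

variable {G : Type*} [Group G] [TopologicalSpace G]

theorem UnitaryRep.mul_apply (U : UnitaryRep G H) (g h : G) (x : H) :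
    (U.toHom (g * h) : H →L[ℂ] H) x = (U.toHom g : H →L[ℂ] H) ((U.toHom h : H →L[ℂ] H) x) := by
  rw [map_mul]
  rfl

theorem UnitaryRep.one_apply (U : UnitaryRep G H) (x : H) : (U.toHom 1 : H →L[ℂ] H) x = x := by
  rw [map_one]
  rfl

theorem UnitaryRep.inner_apply_apply (U : UnitaryRep G H) (g h : G) (x : H) :
    ⟪(U.toHom g : H →L[ℂ] H) x, (U.toHom h : H →L[ℂ] H) x⟫_ℂ = charFn U x (g⁻¹ * h) := by
  rw [charFn, ← inner_unitary_apply (U.toHom g) x, ← U.mul_apply, mul_inv_cancel_left]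

theorem UnitaryRep.norm_apply (U : UnitaryRep G H) (g : G) (x : H) :
    ‖(U.toHom g : H →L[ℂ] H) x‖ = ‖x‖ := by
  rw [← sq_eq_sq₀ (norm_nonneg _) (norm_nonneg _), ← Complex.ofReal_inj]
  simpa [inner_self_eq_norm_sq_to_K] using inner_unitary_apply (U.toHom g) x x

theorem charFn_one (U : UnitaryRep G H) {x : H} (hx : ‖x‖ = 1) : charFn U x 1 = 1 := by
  rw [charFn, U.one_apply, inner_self_eq_norm_sq_to_K, hx]
  simp

theorem exists_isPositiveDefinite_of_covariantlyConvertible (U : UnitaryRep G H)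
    (V : UnitaryRep G K) (ψ : H) (φ : K) (hφ : ‖φ‖ = 1)
    (h : CovariantlyConvertible U V (pureState ψ) (pureState φ)) :
    ∃ f : G → ℂ, IsPositiveDefinite f ∧ ∀ g : G, charFn U ψ g = charFn V φ g * f g := by
  obtain ⟨E, ⟨hcp, htp⟩, hcov, hE⟩ := h
  let a : G → H := fun g => (U.toHom g : H →L[ℂ] H) ψ
  let b : G → K := fun g => (V.toHom g : K →L[ℂ] K) φ
  -- The coefficient of `E(|a g⟩⟨a h|)` along `|b g⟩⟨b h|`.
  let c : G → G → ℂ := fun g h => ⟪b g, (E (ketBra (a g) (a h))).1 (b h)⟫_ℂ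
  have hinv : ∀ k g h, c (k * g) (k * h) = c g h := by
    intro k g h
    simp only [c, a, b, U.mul_apply, V.mul_apply]
    rw [← conj_ketBra, hcov]
    change ⟪_, (V.toHom k : K →L[ℂ] K) ((E _).1 (star (V.toHom k : K →L[ℂ] K) _))⟫_ℂ = _
    rw [inner_unitary_apply]
    congr 2
    change (star (V.toHom k : K →L[ℂ] K) * (V.toHom k : K →L[ℂ] K)) _ = _
    rw [Unitary.coe_star_mul_self]
    rfl
  have hdiag : ∀ g, E (ketBra (a g) (a g)) = pureState (b g) := by
    intro g
    rw [← conj_ketBra, hcov, ketBra_self, hE, ← ketBra_self, conj_ketBra, ketBra_self]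
  have hcblock : ∀ (n : ℕ) (g : Fin n → G),
      BlockPositive ((Matrix.of fun i j => ketBra (a (g i)) (a (g j))).map E) :=
    fun n g => hcp n _ (blockPositive_ketBra fun i => a (g i))
  have hpos : ∀ (n : ℕ) (g : Fin n → G) (z : Fin n → ℂ),
      0 ≤ ∑ i, ∑ j, star (z i) * c (g i) (g j) * z j := by
    intro n g z
    -- Testing block positivity on multiples of the `b (g i)` leaves the scalar quadratic form of
    -- `c`.
    convert hcblock n g (fun i => z i • b (g i)) using 4 with i _ j _
    simp only [Matrix.map_apply, Matrix.of_apply, map_smul, inner_smul_left, inner_smul_right, c,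
      Complex.star_def]
    ring
  refine ⟨fun g => c g 1, ?_, ?_⟩
  · intro n g
    -- Invariance exchanges the two indices, so the matrix of `f` is the transpose of the matrix of
    -- `c`.
    have hc : ∀ i j, c ((g i)⁻¹ * g j) 1 = c (g j) (g i) := fun i j => by
      rw [← hinv (g i), mul_inv_cancel_left, mul_one]
    simp only [hc]
    refine Matrix.PosSemidef.transpose (M := Matrix.of fun i j => c (g i) (g j)) ?_
    refine posSemidef_of_forall_sum_nonneg fun z => ?_
    simpa only [Matrix.of_apply] using hpos n g z
  · intro g
    -- Two group elements suffice: the off-diagonal block for `g` and `1` is a multiple of `|b g⟩⟨b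
    -- 1|`, and comparing traces before and after `E` gives the factorization.
    have h := (hcblock 2 ![g, 1]).eq_smul_rankOne (i := 0) (j := 1) (a := b g) (b := b 1)
      (by decide) (by simp [b, V.norm_apply, hφ]) (by simp [b, hφ])
      (hdiag g) (hdiag 1)
    have ht : trace (E (ketBra (a g) (a 1))) = c g 1 * ⟪b 1, b g⟫_ℂ := trace_smul_ketBra _ _ _ _ h
    rw [htp, trace_smul_ketBra _ 1 (a g) (a 1) (one_smul _ _).symm, one_mul,
      U.inner_apply_apply, V.inner_apply_apply, inv_one, one_mul] at ht
    rw [ht, mul_comm]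

end Forward

/-! ### Hilbert–Schmidt factorization of trace-class operators -/

section HilbertSchmidt

variable {H K : Type*} [NormedAddCommGroup H] [InnerProductSpace ℂ H] [CompleteSpace H]
  [NormedAddCommGroup K] [InnerProductSpace ℂ K] [CompleteSpace K]

/-- The squared Hilbert–Schmidt norm. -/
def hsNormSq (S : H →L[ℂ] K) : ENNReal := ∑' l, ENNReal.ofReal (‖S (onb H l)‖ ^ 2)

theorem hsNormSq_eq_tsum_inner (S : H →L[ℂ] K) :
    hsNormSq S = ∑' l, ∑' k, ENNReal.ofReal (‖⟪onb K k, S (onb H l)⟫_ℂ‖ ^ 2) := by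
  simp_rw [hsNormSq, ← tsum_enorm_sq (onb K) (S _)]

theorem hsNormSq_adjoint (S : H →L[ℂ] K) : hsNormSq (adjoint S) = hsNormSq S := by
  rw [hsNormSq_eq_tsum_inner, hsNormSq_eq_tsum_inner, ENNReal.tsum_comm]
  refine tsum_congr fun k => tsum_congr fun i => ?_
  rw [adjoint_inner_right, norm_inner_symm]

/-- Parseval for `S x`, then Cauchy–Schwarz on each coordinate `⟪S† eₖ, x⟫`. -/
theorem norm_apply_sq_le (S : H →L[ℂ] K) (x : H) :
    ENNReal.ofReal (‖S x‖ ^ 2) ≤ ENNReal.ofReal (‖x‖ ^ 2) * hsNormSq S := by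
  rw [← tsum_enorm_sq (onb K) (S x), ← hsNormSq_adjoint, hsNormSq, ← ENNReal.tsum_mul_left]
  refine ENNReal.tsum_le_tsum fun k => ?_
  rw [← ENNReal.ofReal_mul (by positivity), ← mul_pow]
  refine ENNReal.ofReal_le_ofReal (pow_le_pow_left₀ (norm_nonneg _) ?_ 2)
  rw [← adjoint_inner_left, mul_comm]
  exact norm_inner_le_norm _ _

/-- The operator norm is at most the Hilbert–Schmidt norm. This bound makes Kraus sums converge
absolutely in operator norm. -/
theorem norm_comp_adjoint_le (S : H →L[ℂ] K) (hS : hsNormSq S ≠ ⊤) :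
    ‖S ∘L adjoint S‖ ≤ (hsNormSq S).toReal := by
  have h : ‖S‖ ≤ √(hsNormSq S).toReal := by
    refine S.opNorm_le_bound (Real.sqrt_nonneg _) fun x => ?_
    rw [← Real.sqrt_sq (norm_nonneg x), ← Real.sqrt_mul ENNReal.toReal_nonneg]
    refine Real.le_sqrt_of_sq_le ?_
    have := ENNReal.toReal_mono (ENNReal.mul_ne_top ENNReal.ofReal_ne_top hS) (norm_apply_sq_le S x)
    rwa [ENNReal.toReal_ofReal (by positivity), ENNReal.toReal_mul,
      ENNReal.toReal_ofReal (by positivity), mul_comm] at this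
  calc ‖S ∘L adjoint S‖ ≤ ‖S‖ * ‖adjoint S‖ := opNorm_comp_le _ _
    _ = ‖S‖ * ‖S‖ := by rw [LinearIsometryEquiv.norm_map]
    _ ≤ _ := by
      rw [← Real.mul_self_sqrt (ENNReal.toReal_nonneg (a := hsNormSq S))]
      exact mul_self_le_mul_self (norm_nonneg _) h

theorem inner_comp_adjoint_self (S : H →L[ℂ] K) (x : K) :
    ⟪x, (S ∘L adjoint S) x⟫_ℂ = ((‖adjoint S x‖ ^ 2 : ℝ) : ℂ) := by
  rw [comp_apply, ← adjoint_inner_left, inner_self_eq_norm_sq_to_K]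
  simp

theorem comp_adjoint_mem (S : H →L[ℂ] K) (hS : hsNormSq S ≠ ⊤) :
    S ∘L adjoint S ∈ positiveTraceClass K := by
  refine ⟨isPositive_self_comp_adjoint S, ?_⟩
  simp only [inner_comp_adjoint_self, Complex.ofReal_re]
  rw [← hsNormSq_adjoint, hsNormSq] at hS
  simpa [ENNReal.toReal_ofReal, sq_nonneg] using ENNReal.summable_toReal hS

theorem trace_eq_toReal_tsum {T : traceClass H} (hT : T.1 ∈ positiveTraceClass H) :
    trace T = (((∑' i, ENNReal.ofReal (⟪onb H i, T.1 (onb H i)⟫_ℂ).re).toReal : ℝ) : ℂ) := by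
  have hre : ∀ x : H, ((⟪x, T.1 x⟫_ℂ).re : ℂ) = ⟪x, T.1 x⟫_ℂ := fun x =>
    (Complex.eq_re_of_ofReal_le (hT.1.inner_nonneg_right x)).symm
  rw [← ENNReal.ofReal_tsum_of_nonneg (fun _ => re_inner_nonneg hT.1 _) hT.2,
    ENNReal.toReal_ofReal (tsum_nonneg fun _ => re_inner_nonneg hT.1 _), Complex.ofReal_tsum, trace]
  exact tsum_congr fun i => (hre _).symm

/-- The factor is the positive square root of `T`. -/
theorem exists_eq_comp_adjoint {T : H →L[ℂ] H} (hT : T ∈ positiveTraceClass H) :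
    ∃ S : H →L[ℂ] H, T = S ∘L adjoint S ∧ hsNormSq S ≠ ⊤ := by
  have hn : 0 ≤ T := (nonneg_iff_isPositive T).2 hT.1
  have hadj : adjoint (CFC.sqrt T) = CFC.sqrt T := IsSelfAdjoint.of_nonneg (CFC.sqrt_nonneg T)
  have e : T = CFC.sqrt T ∘L adjoint (CFC.sqrt T) := by
    rw [hadj]
    exact (CFC.sqrt_mul_sqrt_self T hn).symm
  refine ⟨CFC.sqrt T, e, ?_⟩
  have h := hT.2.tsum_ofReal_ne_top
  have h2 : ∀ x, (⟪x, T x⟫_ℂ).re = ‖adjoint (CFC.sqrt T) x‖ ^ 2 := fun x => by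
    conv_lhs => rw [e]
    rw [inner_comp_adjoint_self, Complex.ofReal_re]
  simp only [h2] at h
  rwa [← hsNormSq_adjoint]

/-- Trace-class operators are spanned by the operators `S S†` with `S` Hilbert–Schmidt. -/
theorem traceClass_induction {p : (H →L[ℂ] H) → Prop} {T : H →L[ℂ] H} (hT : T ∈ traceClass H)
    (h_comp : ∀ S : H →L[ℂ] H, hsNormSq S ≠ ⊤ → p (S ∘L adjoint S)) (h_zero : p 0)
    (h_add : ∀ S T, S ∈ traceClass H → T ∈ traceClass H → p S → p T → p (S + T))
    (h_smul : ∀ (a : ℂ) T, T ∈ traceClass H → p T → p (a • T)) : p T := by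
  induction hT using Submodule.span_induction with
  | mem T hT =>
    obtain ⟨S, rfl, hS⟩ := exists_eq_comp_adjoint hT
    exact h_comp S hS
  | zero => exact h_zero
  | add S T h1 h2 hS hT => exact h_add S T h1 h2 hS hT
  | smul a T h hT => exact h_smul a T h hT

theorem trace_add (S T : traceClass H) : trace (S + T) = trace S + trace T := by
  refine (hasSum_trace (onb H) (S + T)).unique ?_
  simpa [inner_add_right] using (hasSum_trace (onb H) S).add (hasSum_trace (onb H) T)

theorem trace_smul (a : ℂ) (T : traceClass H) : trace (a • T) = a * trace T := by
  refine (hasSum_trace (onb H) (a • T)).unique ?_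
  simpa [inner_smul_right] using (hasSum_trace (onb H) T).mul_left a

theorem trace_comp_adjoint (S : H →L[ℂ] K) (hS : hsNormSq S ≠ ⊤) (T : traceClass K)
    (hT : T.1 = S ∘L adjoint S) : trace T = ((hsNormSq S).toReal : ℂ) := by
  rw [trace_eq_toReal_tsum (by rw [hT]; exact comp_adjoint_mem S hS), ← hsNormSq_adjoint, hsNormSq]
  simp only [hT, inner_comp_adjoint_self, Complex.ofReal_re]

end HilbertSchmidt

/-! ### Channels from infinite Kraus families -/

section Kraus

variable {H K ι : Type*} [NormedAddCommGroup H] [InnerProductSpace ℂ H] [CompleteSpace H]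
  [NormedAddCommGroup K] [InnerProductSpace ℂ K] [CompleteSpace K]

/-- A Kraus family: `∑ᵢ Wᵢ† Wᵢ = 1`, stated as `∑ᵢ ‖Wᵢ x‖² = ‖x‖²`. -/
def IsKrausFamily (W : ι → H →L[ℂ] K) : Prop :=
  ∀ x, ∑' i, ENNReal.ofReal (‖W i x‖ ^ 2) = ENNReal.ofReal (‖x‖ ^ 2)

variable {W : ι → H →L[ℂ] K}

/-- The Kraus identity at each `S eₗ`, summed over `l` by Tonelli. Both convergence of the Kraus sum
and trace preservation rest on it. -/
theorem IsKrausFamily.tsum_hsNormSq (hW : IsKrausFamily W) (S : H →L[ℂ] H) :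
    ∑' i, hsNormSq (W i ∘L S) = hsNormSq S := by
  simp only [hsNormSq, comp_apply]
  rw [ENNReal.tsum_comm]
  exact tsum_congr fun l => hW _

theorem kraus_comp_adjoint (A : H →L[ℂ] K) (S : H →L[ℂ] H) :
    A ∘L (S ∘L adjoint S) ∘L adjoint A = (A ∘L S) ∘L adjoint (A ∘L S) := by
  rw [adjoint_comp]
  rfl

theorem IsKrausFamily.summable (hW : IsKrausFamily W) {T : H →L[ℂ] H} (hT : T ∈ traceClass H) :
    Summable fun i => W i ∘L T ∘L adjoint (W i) := by
  refine traceClass_induction (p := fun T => Summable fun i => W i ∘L T ∘L adjoint (W i)) hT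
    (fun S hS => ?_) ?_ (fun S T _ _ hS hT => ?_) (fun a T _ hT => ?_)
  · simp only [kraus_comp_adjoint]
    have hf : ∑' i, hsNormSq (W i ∘L S) ≠ ⊤ := by rwa [hW.tsum_hsNormSq]
    exact Summable.of_norm_bounded (ENNReal.summable_toReal hf) fun i =>
      norm_comp_adjoint_le _ (ENNReal.ne_top_of_tsum_ne_top hf i)
  · simp
  · simpa [add_comp, comp_add] using hS.add hT
  · simpa [smul_comp, comp_smul] using hT.const_smul a

/-- The operator `∑ᵢ Wᵢ T Wᵢ†`. -/
def krausSum (W : ι → H →L[ℂ] K) (T : H →L[ℂ] H) : K →L[ℂ] K :=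
  ∑' i, W i ∘L T ∘L adjoint (W i)

theorem IsKrausFamily.hasSum_inner (hW : IsKrausFamily W) {T : H →L[ℂ] H} (hT : T ∈ traceClass H)
    (x y : K) :
    HasSum (fun i => ⟪adjoint (W i) x, T (adjoint (W i) y)⟫_ℂ) ⟪x, krausSum W T y⟫_ℂ := by
  have h := ((hW.summable hT).hasSum.mapL (ContinuousLinearMap.apply ℂ K y)).mapL (innerSL ℂ x)
  simp only [adjoint_inner_left]
  exact h

theorem IsKrausFamily.ofReal_inner_krausSum (hW : IsKrausFamily W) (S : H →L[ℂ] H)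
    (hS : hsNormSq S ≠ ⊤) (y : K) :
    0 ≤ ⟪y, krausSum W (S ∘L adjoint S) y⟫_ℂ ∧
    ENNReal.ofReal (⟪y, krausSum W (S ∘L adjoint S) y⟫_ℂ).re =
      ∑' i, ENNReal.ofReal (‖adjoint (W i ∘L S) y‖ ^ 2) := by
  have h := hW.hasSum_inner (Submodule.subset_span (comp_adjoint_mem S hS)) y y
  simp only [inner_comp_adjoint_self] at h
  have h' := h.mapL Complex.reCLM
  simp only [Complex.reCLM_apply, Complex.ofReal_re] at h'
  refine ⟨h.nonneg fun i => Complex.zero_le_real.2 (by positivity), ?_⟩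
  rw [← h'.tsum_eq, ENNReal.ofReal_tsum_of_nonneg (fun _ => by positivity) h'.summable]
  simp only [adjoint_comp, comp_apply]

/-- Splitting `S S†` into the pure states of the vectors `S eₗ` lets identities between channels be
checked on vectors. -/
theorem IsKrausFamily.ofReal_inner_krausSum_eq_tsum (hW : IsKrausFamily W) (S : H →L[ℂ] H)
    (hS : hsNormSq S ≠ ⊤) (y : K) :
    ENNReal.ofReal (⟪y, krausSum W (S ∘L adjoint S) y⟫_ℂ).re =
      ∑' l, ∑' i, ENNReal.ofReal (‖⟪y, W i (S (onb H l))⟫_ℂ‖ ^ 2) := by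
  rw [(hW.ofReal_inner_krausSum S hS y).2, ENNReal.tsum_comm]
  refine tsum_congr fun i => ?_
  rw [← tsum_enorm_sq (onb H)]
  refine tsum_congr fun l => ?_
  rw [adjoint_inner_right, norm_inner_symm, comp_apply]

theorem IsKrausFamily.tsum_diag (hW : IsKrausFamily W) (S : H →L[ℂ] H) (hS : hsNormSq S ≠ ⊤) :
    ∑' k, ENNReal.ofReal (⟪onb K k, krausSum W (S ∘L adjoint S) (onb K k)⟫_ℂ).re =
      hsNormSq S := by
  simp only [(hW.ofReal_inner_krausSum S hS _).2]
  rw [ENNReal.tsum_comm, ← hW.tsum_hsNormSq S]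
  exact tsum_congr fun i => hsNormSq_adjoint _

theorem IsKrausFamily.krausSum_mem_positive (hW : IsKrausFamily W) (S : H →L[ℂ] H)
    (hS : hsNormSq S ≠ ⊤) : krausSum W (S ∘L adjoint S) ∈ positiveTraceClass K := by
  have hp : (krausSum W (S ∘L adjoint S)).IsPositive := by
    rw [isPositive_iff_complex]
    intro y
    have h := (hW.ofReal_inner_krausSum S hS y).1
    rw [← inner_conj_symm, ← Complex.star_def, (IsSelfAdjoint.of_nonneg h).star_eq]
    exact ⟨(Complex.eq_re_of_ofReal_le h).symm, (Complex.le_def.1 h).1⟩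
  refine ⟨hp, ?_⟩
  have h := ENNReal.summable_toReal ((hW.tsum_diag S hS).symm ▸ hS)
  simpa [ENNReal.toReal_ofReal (re_inner_nonneg hp _)] using h

theorem IsKrausFamily.krausSum_add (hW : IsKrausFamily W) {S T : H →L[ℂ] H}
    (hS : S ∈ traceClass H) (hT : T ∈ traceClass H) :
    krausSum W (S + T) = krausSum W S + krausSum W T := by
  rw [krausSum, krausSum, krausSum, ← (hW.summable hS).tsum_add (hW.summable hT)]
  simp only [add_comp, comp_add]

theorem krausSum_smul (a : ℂ) (T : H →L[ℂ] H) : krausSum W (a • T) = a • krausSum W T := by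
  rw [krausSum, krausSum, ← tsum_const_smul'']
  simp only [smul_comp, comp_smul]

theorem krausSum_zero : krausSum W (0 : H →L[ℂ] H) = 0 := by simp [krausSum]

theorem IsKrausFamily.krausSum_mem (hW : IsKrausFamily W) {T : H →L[ℂ] H}
    (hT : T ∈ traceClass H) : krausSum W T ∈ traceClass K := by
  refine traceClass_induction (p := fun T => krausSum W T ∈ traceClass K) hT
    (fun S hS => Submodule.subset_span (hW.krausSum_mem_positive S hS)) ?_
    (fun S T h1 h2 hS hT => ?_) (fun a T _ hT => ?_)
  · rw [krausSum_zero]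
    exact zero_mem _
  · rw [hW.krausSum_add h1 h2]
    exact add_mem hS hT
  · rw [krausSum_smul]
    exact Submodule.smul_mem _ _ hT

/-- The quantum channel `T ↦ ∑ᵢ Wᵢ T Wᵢ†` of a Kraus family. -/
def IsKrausFamily.channel (hW : IsKrausFamily W) : traceClass H →ₗ[ℂ] traceClass K where
  toFun T := ⟨krausSum W T.1, hW.krausSum_mem T.2⟩
  map_add' S T := Subtype.ext (hW.krausSum_add S.2 T.2)
  map_smul' a T := Subtype.ext (krausSum_smul a T.1)

theorem IsKrausFamily.channel_apply (hW : IsKrausFamily W) (T : traceClass H) :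
    (hW.channel T).1 = krausSum W T.1 := rfl

theorem IsKrausFamily.isQuantumChannel (hW : IsKrausFamily W) : IsQuantumChannel hW.channel := by
  constructor
  · intro n A hA x
    have h : HasSum (fun k => ∑ i, ∑ j, ⟪adjoint (W k) (x i), (A i j).1 (adjoint (W k) (x j))⟫_ℂ)
        (∑ i, ∑ j, ⟪x i, ((A.map hW.channel) i j).1 (x j)⟫_ℂ) :=
      hasSum_sum fun i _ => hasSum_sum fun j _ => hW.hasSum_inner (A i j).2 (x i) (x j)
    exact h.nonneg fun k => hA fun i => adjoint (W k) (x i)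
  · rintro ⟨T, hT⟩
    refine traceClass_induction (p := fun T => ∀ hT : T ∈ traceClass H,
      trace (hW.channel ⟨T, hT⟩) = trace ⟨T, hT⟩) hT (fun S hS hT => ?_) (fun h => ?_)
      (fun S T h1 h2 hS hT h => ?_) (fun a T h1 hT h => ?_) hT
    · rw [trace_comp_adjoint S hS ⟨_, hT⟩ rfl, trace_eq_toReal_tsum (hW.krausSum_mem_positive S hS)]
      simp only [channel_apply, hW.tsum_diag S hS]
    · have : (⟨0, h⟩ : traceClass H) = (0 : ℂ) • 0 := by simp
      rw [this, map_smul, trace_smul, trace_smul, zero_mul, zero_mul]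
    · have : (⟨S + T, h⟩ : traceClass H) = ⟨S, h1⟩ + ⟨T, h2⟩ := rfl
      rw [this, map_add, trace_add, trace_add, hS, hT]
    · have : (⟨a • T, h⟩ : traceClass H) = a • ⟨T, h1⟩ := rfl
      rw [this, map_smul, trace_smul, trace_smul, hT]

theorem eq_of_forall_inner_self {S T : K →L[ℂ] K} (h : ∀ y, ⟪y, S y⟫_ℂ = ⟪y, T y⟫_ℂ) : S = T := by
  refine ContinuousLinearMap.coe_injective ((ext_inner_map _ _).1 fun y => ?_)
  have := congrArg (starRingEnd ℂ) (h y)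
  simpa only [inner_conj_symm, coe_coe] using this

theorem eq_of_forall_ofReal_inner_self {S T : K →L[ℂ] K} (hS : S.IsPositive) (hT : T.IsPositive)
    (h : ∀ y, ENNReal.ofReal (⟪y, S y⟫_ℂ).re = ENNReal.ofReal (⟪y, T y⟫_ℂ).re) : S = T := by
  refine eq_of_forall_inner_self fun y => ?_
  have h1 := (Complex.eq_re_of_ofReal_le (hS.inner_nonneg_right y))
  have h2 := (Complex.eq_re_of_ofReal_le (hT.inner_nonneg_right y))
  rw [h1, h2, Complex.ofReal_inj]
  exact (ENNReal.ofReal_eq_ofReal_iff (re_inner_nonneg hS y) (re_inner_nonneg hT y)).1 (h y)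

theorem inner_rankOne_apply_self (y z : K) :
    ⟪y, rankOne ℂ z z y⟫_ℂ = ((‖⟪y, z⟫_ℂ‖ ^ 2 : ℝ) : ℂ) := by
  rw [rankOne_apply, inner_smul_right, ← inner_conj_symm z y, ← Complex.normSq_eq_conj_mul_self,
    Complex.normSq_eq_norm_sq]

/-- The hypothesis compares the quadratic forms of the two operators, and over `ℂ` these determine
the operators by polarization. -/
theorem IsKrausFamily.channel_pureState (hW : IsKrausFamily W) {x : H} {a : K}
    (h : ∀ y, ∑' i, ENNReal.ofReal (‖⟪y, W i x⟫_ℂ‖ ^ 2) = ENNReal.ofReal (‖⟪y, a⟫_ℂ‖ ^ 2)) :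
    hW.channel (pureState x) = pureState a := by
  suffices krausSum W (rankOne ℂ x x) = rankOne ℂ a a from Subtype.ext this
  refine eq_of_forall_inner_self fun y => ?_
  have hs := hW.hasSum_inner (rankOne_mem x) y y
  simp only [inner_rankOne_apply_self] at hs
  simp only [adjoint_inner_left] at hs
  have hr := Complex.summable_ofReal.1 hs.summable
  have h' := h y
  rw [← ENNReal.ofReal_tsum_of_nonneg (fun _ => by positivity) hr,
    ENNReal.ofReal_eq_ofReal_iff (tsum_nonneg fun _ => by positivity) (by positivity)] at h'
  rw [inner_rankOne_apply_self, ← h', Complex.ofReal_tsum]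
  exact hs.tsum_eq.symm

variable {G : Type*} [Group G] [TopologicalSpace G]

/-- The hypothesis is covariance on pure states, read through quadratic forms. Summing over the
vectors `S eₗ` extends it to `S S†`, and these operators span. -/
theorem IsKrausFamily.isCovariant (hW : IsKrausFamily W) (U : UnitaryRep G H) (V : UnitaryRep G K)
    (h : ∀ g x y, ∑' i, ENNReal.ofReal (‖⟪y, W i ((U.toHom g : H →L[ℂ] H) x)⟫_ℂ‖ ^ 2) =
      ∑' i, ENNReal.ofReal (‖⟪star (V.toHom g : K →L[ℂ] K) y, W i x⟫_ℂ‖ ^ 2)) :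
    IsCovariant U V hW.channel := by
  rintro g ⟨T, hT⟩
  refine Subtype.ext ?_
  change krausSum W ((U.toHom g : H →L[ℂ] H) * T * star (U.toHom g : H →L[ℂ] H)) =
    (V.toHom g : K →L[ℂ] K) * krausSum W T * star (V.toHom g : K →L[ℂ] K)
  refine traceClass_induction (p := fun T => krausSum W
    ((U.toHom g : H →L[ℂ] H) * T * star (U.toHom g : H →L[ℂ] H)) =
    (V.toHom g : K →L[ℂ] K) * krausSum W T * star (V.toHom g : K →L[ℂ] K)) hT
    (fun S hS => ?_) ?_ (fun S T h1 h2 hS hT => ?_) (fun a T h1 hT => ?_)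
  · have e : (U.toHom g : H →L[ℂ] H) * (S ∘L adjoint S) * star (U.toHom g : H →L[ℂ] H) =
        ((U.toHom g : H →L[ℂ] H) ∘L S) ∘L adjoint ((U.toHom g : H →L[ℂ] H) ∘L S) :=
      by rw [mul_def, mul_def, star_eq_adjoint, ← kraus_comp_adjoint, comp_assoc]
    have hS' : hsNormSq ((U.toHom g : H →L[ℂ] H) ∘L S) ≠ ⊤ := by
      simpa only [hsNormSq, comp_apply, U.norm_apply] using hS
    rw [e]
    have hp : ((V.toHom g : K →L[ℂ] K) * krausSum W (S ∘L adjoint S) *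
        star (V.toHom g : K →L[ℂ] K)).IsPositive := by
      rw [mul_def, mul_def, star_eq_adjoint, comp_assoc]
      exact (hW.krausSum_mem_positive _ hS).1.conj_adjoint _
    refine eq_of_forall_ofReal_inner_self (hW.krausSum_mem_positive _ hS').1 hp fun y => ?_
    have e2 : ⟪y, ((V.toHom g : K →L[ℂ] K) * krausSum W (S ∘L adjoint S) *
        star (V.toHom g : K →L[ℂ] K)) y⟫_ℂ = ⟪star (V.toHom g : K →L[ℂ] K) y,
        krausSum W (S ∘L adjoint S) (star (V.toHom g : K →L[ℂ] K) y)⟫_ℂ :=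
      by rw [mul_def, mul_def, comp_apply, comp_apply, unitary_inner_right]
    rw [hW.ofReal_inner_krausSum_eq_tsum _ hS', e2, hW.ofReal_inner_krausSum_eq_tsum _ hS]
    exact tsum_congr fun l => h g _ _
  · simp [krausSum_zero]
  · rw [mul_add, add_mul, hW.krausSum_add (unitary_conj_mem _ h1) (unitary_conj_mem _ h2),
      hW.krausSum_add h1 h2, hS, hT, mul_add, add_mul]
  · rw [mul_smul_comm, smul_mul_assoc, krausSum_smul, hT, krausSum_smul, mul_smul_comm,
      smul_mul_assoc]

end Kraus

/-! ### Families of vectors with equal Gram matrices -/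

section Gram

variable {H N X : Type*} [NormedAddCommGroup H] [InnerProductSpace ℂ H]
  [NormedAddCommGroup N] [InnerProductSpace ℂ N]

theorem norm_linearCombination_eq {a : X → H} {b : X → N}
    (hab : ∀ g h, ⟪a g, a h⟫_ℂ = ⟪b g, b h⟫_ℂ) (c : X →₀ ℂ) :
    ‖Finsupp.linearCombination ℂ a c‖ = ‖Finsupp.linearCombination ℂ b c‖ := by
  have h : ⟪Finsupp.linearCombination ℂ a c, Finsupp.linearCombination ℂ a c⟫_ℂ =
      ⟪Finsupp.linearCombination ℂ b c, Finsupp.linearCombination ℂ b c⟫_ℂ := by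
    simp only [Finsupp.linearCombination_apply, Finsupp.sum_inner, Finsupp.inner_sum,
      inner_smul_left, inner_smul_right, hab]
  rw [inner_self_eq_norm_sq_to_K, inner_self_eq_norm_sq_to_K] at h
  exact (sq_eq_sq₀ (norm_nonneg _) (norm_nonneg _)).1 (by exact_mod_cast h)

/-- The closed linear span of a family of vectors. -/
abbrev closedSpan (a : X → H) : Submodule ℂ H := (Submodule.span ℂ (Set.range a)).topologicalClosure

theorem mem_closedSpan (a : X → H) (g : X) : a g ∈ closedSpan a :=
  Submodule.le_topologicalClosure _ (Submodule.subset_span ⟨g, rfl⟩)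

theorem closedSpan_induction {a : X → H} {p : H → Prop} (hp : IsClosed {x | p x})
    (h : ∀ c, p (Finsupp.linearCombination ℂ a c)) {x : H} (hx : x ∈ closedSpan a) : p x := by
  refine closure_minimal (fun z hz => ?_) hp hx
  obtain ⟨c, rfl⟩ := (Finsupp.mem_span_range_iff_exists_finsupp).1 hz
  exact h c

/-- Equal norms on the orbit alone would not pass to its span; equal Gram entries do, and continuity
reaches the closure. -/
theorem norm_apply_eq_of_gram_eq {N' : Type*} [NormedAddCommGroup N'] [InnerProductSpace ℂ N']
    {a : X → H} {A : H →L[ℂ] N} {B : H →L[ℂ] N'}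
    (hab : ∀ g h, ⟪A (a g), A (a h)⟫_ℂ = ⟪B (a g), B (a h)⟫_ℂ) {x : H} (hx : x ∈ closedSpan a) :
    ‖A x‖ = ‖B x‖ := by
  refine closedSpan_induction (p := fun x => ‖A x‖ = ‖B x‖)
    (isClosed_eq (by fun_prop) (by fun_prop)) (fun c => ?_) hx
  have h := norm_linearCombination_eq (a := A ∘ a) (b := B ∘ a) hab c
  simpa [Finsupp.linearCombination_apply, Finsupp.sum, map_sum] using h

variable [CompleteSpace H] [CompleteSpace N]

/-- Two families with the same Gram matrix are related by a partial isometry. -/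
theorem exists_partialIsometry {a : X → H} {b : X → N}
    (hab : ∀ g h, ⟪a g, a h⟫_ℂ = ⟪b g, b h⟫_ℂ) :
    ∃ A : H →L[ℂ] N, (∀ g, A (a g) = b g) ∧ ∀ x, ‖A x‖ = ‖(closedSpan a).starProjection x‖ := by
  let e : (X →₀ ℂ) →ₗ[ℂ] closedSpan a := (Finsupp.linearCombination ℂ a).codRestrict _ fun c =>
    Submodule.le_topologicalClosure _
      (Finsupp.mem_span_range_iff_exists_finsupp.2 ⟨c, rfl⟩)
  let f : (X →₀ ℂ) →ₗ[ℂ] N := Finsupp.linearCombination ℂ b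
  have hn : ∀ c, ‖f c‖ = ‖e c‖ := fun c => (norm_linearCombination_eq hab c).symm
  have hd : DenseRange e := by
    rintro ⟨x, hx⟩
    rw [closure_subtype]
    refine closure_mono ?_ hx
    intro z hz
    obtain ⟨c, rfl⟩ := (Finsupp.mem_span_range_iff_exists_finsupp).1 hz
    exact ⟨e c, ⟨c, rfl⟩, rfl⟩
  -- Equal norms make `e c ↦ f c` well defined and isometric on a dense subspace of the closed span,
  -- so it extends; composing with the orthogonal projection gives a map on all of `H`.
  have he : ∀ c, f.extendOfNorm e (e c) = f c :=
    LinearMap.extendOfNorm_eq hd ⟨1, fun c => by rw [hn, one_mul]⟩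
  have hiso : ∀ x, ‖f.extendOfNorm e x‖ = ‖x‖ := fun x =>
    hd.induction_on (p := fun x => ‖f.extendOfNorm e x‖ = ‖x‖) x
      (isClosed_eq (by fun_prop) (by fun_prop)) fun c => by rw [he, hn]
  refine ⟨f.extendOfNorm e ∘L (closedSpan a).orthogonalProjectionOnto, fun g => ?_, fun x => ?_⟩
  · have h1 : (closedSpan a).orthogonalProjectionOnto (a g) = e (Finsupp.single g 1) := by
      have : e (Finsupp.single g 1) = ⟨a g, mem_closedSpan a g⟩ := Subtype.ext (by simp [e])
      rw [this]
      exact Submodule.orthogonalProjectionOnto_mem_subspace_eq_self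
        (⟨a g, mem_closedSpan a g⟩ : closedSpan a)
    rw [comp_apply, h1, he]
    simp [f]
  · rw [comp_apply, hiso, Submodule.starProjection_apply, Submodule.coe_norm]

end Gram

/-! ### Square-summable families of vectors -/

section SquareSummable

variable {K J : Type*} [NormedAddCommGroup K] [InnerProductSpace ℂ K]

theorem memlp_two_iff {f : J → K} : Memℓp f 2 ↔ Summable fun j => ‖f j‖ ^ 2 := by
  rw [memℓp_gen_iff (by norm_num)]
  simp

theorem lp_tsum_norm_sq (f : lp (fun _ : J => K) 2) :
    ∑' j, ENNReal.ofReal (‖f j‖ ^ 2) = ENNReal.ofReal (‖f‖ ^ 2) := by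
  have h := (lp.hasSum_inner (𝕜 := ℂ) f f).mapL Complex.reCLM
  simp only [inner_self_eq_norm_sq_to_K, Complex.coe_algebraMap, ← Complex.ofReal_pow,
    Complex.reCLM_apply, Complex.ofReal_re] at h
  rw [← h.tsum_eq, ENNReal.ofReal_tsum_of_nonneg (fun _ => by positivity) h.summable]

/-- Entrywise inner product with a fixed vector, from `ℓ²(J, K)` to `ℓ²(J)`. -/
def lpInner (J : Type*) (y : K) : lp (fun _ : J => K) 2 →L[ℂ] lp (fun _ : J => ℂ) 2 :=
  LinearMap.mkContinuous
    { toFun := fun f => ⟨fun j => ⟪y, f j⟫_ℂ, memlp_two_iff.2 <|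
        ((memlp_two_iff.1 f.2).mul_left (‖y‖ ^ 2)).of_nonneg_of_le (fun _ => by positivity)
          fun j => by
            rw [← mul_pow]
            exact pow_le_pow_left₀ (norm_nonneg _) (norm_inner_le_norm _ _) 2⟩
      map_add' := fun f g => lp.ext (funext fun j => inner_add_right _ _ _)
      map_smul' := fun c f => lp.ext (funext fun j => inner_smul_right _ _ _) } ‖y‖ fun f => by
    refine (sq_le_sq₀ (norm_nonneg _) (by positivity)).1 ?_
    rw [← ENNReal.ofReal_le_ofReal_iff (by positivity), ← lp_tsum_norm_sq, mul_pow,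
      ENNReal.ofReal_mul (by positivity), ← lp_tsum_norm_sq f, ← ENNReal.tsum_mul_left]
    refine ENNReal.tsum_le_tsum fun j => ?_
    rw [← ENNReal.ofReal_mul (by positivity), ← mul_pow]
    exact ENNReal.ofReal_le_ofReal
      (pow_le_pow_left₀ (norm_nonneg _) (norm_inner_le_norm y (f j)) 2)

theorem lpInner_apply (y : K) (f : lp (fun _ : J => K) 2) (j : J) :
    lpInner J y f j = ⟪y, f j⟫_ℂ := rfl

end SquareSummable

/-! ### Features of a positive definite function -/

section Kernel

universe u
variable {G : Type u} [Group G]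

open RKHS in
-- The features are the coordinates, in an orthonormal basis of the reproducing kernel space of
-- `f(g⁻¹h)`, of the kernel functions at the points of `G`.
theorem IsPositiveDefinite.exists_features {f : G → ℂ} (hf : IsPositiveDefinite f) :
    ∃ (J : Type u) (m : J → G → ℂ),
      ∀ g h, HasSum (fun j => star (m j g) * m j h) (f (g⁻¹ * h)) := by
  -- Hermitian symmetry of the `2 × 2` matrix at the points `1` and `g`.
  have hstar : ∀ g, star (f g) = f g⁻¹ := fun g => by
    have := (hf 2 ![1, g]).isHermitian.apply 1 0
    simpa using this
  let A : Matrix G G (ℂ →L[ℂ] ℂ) := .of fun g h => f (g⁻¹ * h) • ContinuousLinearMap.id ℂ ℂ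
  have hA : A.PosSemidef := by
    have key := (posSemidef_tfae (K := A)).out 0 2
    refine key.2 ⟨?_, fun v => ?_⟩
    · ext g h
      rw [Matrix.conjTranspose_apply]
      simp only [A, Matrix.of_apply, star_smul, hstar, mul_inv_rev, inv_inv]
      rw [show star (ContinuousLinearMap.id ℂ ℂ) = ContinuousLinearMap.id ℂ ℂ from star_one _]
    · let n := v.support.card
      let e : Fin n ≃ v.support := v.support.equivFin.symm
      have h := (hf n fun i => (e i : G)).dotProduct_mulVec_nonneg fun i => v (e i)
      have hs : (v.sum fun x w => v.sum fun x' w' => ⟪A x' x w, w'⟫_ℂ) =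
          ∑ i, ∑ j, star (v (e i)) * f ((e i : G)⁻¹ * e j) * v (e j) := by
        simp only [Finsupp.sum]
        rw [← Finset.sum_coe_sort, ← e.sum_comp]
        refine Finset.sum_congr rfl fun i _ => ?_
        rw [← Finset.sum_coe_sort, ← e.sum_comp]
        refine Finset.sum_congr rfl fun j _ => ?_
        simp only [A, Matrix.of_apply, smul_apply, id_apply, smul_eq_mul, RCLike.inner_apply,
          map_mul, ← Complex.star_def, hstar, mul_inv_rev, inv_inv]
        ring
      rw [hs]
      refine (Complex.le_def.1 (h.trans_eq ?_)).1
      simp only [dotProduct, Matrix.mulVec, Finset.mul_sum, mul_assoc]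
      rfl
  have : Fact A.PosSemidef := ⟨hA⟩
  let η : G → OfKernel A := fun g => kerFun (OfKernel A) g 1
  have hη : ∀ g h, ⟪η g, η h⟫_ℂ = f (g⁻¹ * h) := by
    intro g h
    rw [← kernel_inner, OfKernel.kernel_ofKernel]
    simp [A, ← Complex.star_def, hstar]
  refine ⟨basisIndex (OfKernel A), fun j g => ⟪onb (OfKernel A) j, η g⟫_ℂ, fun g h => ?_⟩
  rw [← hη]
  simpa [Complex.star_def] using (onb (OfKernel A)).hasSum_inner_mul_inner (η g) (η h)

end Kernel

/-! ### An invariant state by Haar averaging -/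

section Haar

open MeasureTheory Filter Topology

variable {G : Type*} [Group G] [TopologicalSpace G] [IsTopologicalGroup G] [CompactSpace G]
  {K : Type*} [NormedAddCommGroup K] [InnerProductSpace ℂ K] [CompleteSpace K]

theorem integrable_of_continuous [MeasurableSpace G] [BorelSpace G] (μ : Measure G)
    [IsFiniteMeasure μ] {E : Type*} [NormedAddCommGroup E] {F : G → E} (hF : Continuous F) :
    Integrable F μ :=
  hF.integrable_of_hasCompactSupport (HasCompactSupport.of_compactSpace _)

/-- An integral of pure states along a continuous family of unit vectors on a compact space is a
positive operator of trace one. -/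
theorem exists_hilbertSchmidt_integral [MeasurableSpace G] [BorelSpace G] (μ : Measure G)
    [IsProbabilityMeasure μ] {v : G → K} (hv : Continuous v) (hn : ∀ g, ‖v g‖ = 1) :
    ∃ S : K →L[ℂ] K, hsNormSq S = 1 ∧
      ∀ y, ‖adjoint S y‖ ^ 2 = ∫ g, ‖⟪y, v g⟫_ℂ‖ ^ 2 ∂μ := by
  have hF : Continuous fun g => rankOne ℂ (v g) (v g) :=
    (smulRightL ℂ K K).continuous₂.comp (((innerSL ℂ).continuous.comp hv).prodMk hv)
  have hFy : ∀ y, Continuous fun g => ‖⟪y, v g⟫_ℂ‖ ^ 2 := fun y => by fun_prop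
  let σ : K →L[ℂ] K := ∫ g, rankOne ℂ (v g) (v g) ∂μ
  have hσ : ∀ y, ⟪y, σ y⟫_ℂ = ((∫ g, ‖⟪y, v g⟫_ℂ‖ ^ 2 ∂μ : ℝ) : ℂ) := by
    intro y
    have h1 := ((innerSL ℂ y) ∘L (ContinuousLinearMap.apply ℂ K y)).integral_comp_comm (integrable_of_continuous μ hF)
    have h2 : ∫ g, ⟪y, rankOne ℂ (v g) (v g) y⟫_ℂ ∂μ = ⟪y, σ y⟫_ℂ := h1
    rw [← h2, ← integral_complex_ofReal]
    simp only [inner_rankOne_apply_self]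
  have hpos : σ.IsPositive := by
    rw [isPositive_iff_complex]
    intro y
    rw [← inner_conj_symm, hσ]
    simp only [Complex.conj_ofReal, RCLike.re_to_complex, Complex.ofReal_re, true_and]
    exact integral_nonneg fun g => by positivity
  have hsum : HasSum (fun k => ∫ g, ‖⟪onb K k, v g⟫_ℂ‖ ^ 2 ∂μ) 1 := by
    have hpt : ∀ g, HasSum (fun k => ‖⟪onb K k, v g⟫_ℂ‖ ^ 2) 1 := by
      intro g
      have h := tsum_enorm_sq (onb K) (v g)
      rw [hn, one_pow] at h
      have h2 := ENNReal.summable_toReal (h.trans_ne ENNReal.ofReal_ne_top)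
      simp only [ENNReal.toReal_ofReal (sq_nonneg ‖_‖)] at h2
      rw [← ENNReal.ofReal_tsum_of_nonneg (fun _ => by positivity) h2,
        ENNReal.ofReal_eq_ofReal_iff (tsum_nonneg fun _ => by positivity) zero_le_one] at h
      exact h ▸ h2.hasSum
    -- Dini's theorem: the partial Parseval sums are continuous and increase to the constant `1`, so
    -- they converge uniformly on the compact group. This allows exchanging sum and integral even
    -- when the basis is uncountable, where monotone convergence for sequences does not apply.
    have hunif := Monotone.tendstoUniformly_of_forall_tendsto
      (F := fun (s : Finset (basisIndex K)) g => ∑ k ∈ s, ‖⟪onb K k, v g⟫_ℂ‖ ^ 2)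
      (f := fun _ => (1 : ℝ)) (fun s => by fun_prop)
      (fun s t hst g => Finset.sum_le_sum_of_subset_of_nonneg hst fun _ _ _ => by positivity)
      continuous_const hpt
    rw [HasSum, Metric.tendsto_nhds]
    intro ε hε
    filter_upwards [Metric.tendstoUniformly_iff.1 hunif (ε / 2) (half_pos hε)] with s hs
    rw [← integral_finsetSum _ fun k _ => integrable_of_continuous μ (hFy _)]
    have h1 : (1 : ℝ) = ∫ _g : G, (1 : ℝ) ∂μ := by simp
    rw [dist_comm, dist_eq_norm]
    nth_rewrite 1 [h1]
    rw [← integral_sub (integrable_const _) (integrable_of_continuous μ (by fun_prop))]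
    refine lt_of_le_of_lt (norm_integral_le_of_norm_le_const (C := ε / 2)
      (Eventually.of_forall fun g => ?_)) ?_
    · rw [← dist_eq_norm]
      exact (hs g).le
    · simpa using half_lt_self hε
  have hmem : σ ∈ positiveTraceClass K := by
    refine ⟨hpos, ?_⟩
    simp only [hσ, Complex.ofReal_re]
    exact hsum.summable
  obtain ⟨S, hS, -⟩ := exists_eq_comp_adjoint hmem
  have hSy : ∀ y, ‖adjoint S y‖ ^ 2 = ∫ g, ‖⟪y, v g⟫_ℂ‖ ^ 2 ∂μ := by
    intro y
    have h := hσ y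
    rw [hS, inner_comp_adjoint_self] at h
    exact_mod_cast h
  refine ⟨S, ?_, hSy⟩
  rw [← hsNormSq_adjoint, hsNormSq]
  simp only [hSy]
  rw [← ENNReal.ofReal_tsum_of_nonneg (fun _ => integral_nonneg fun g => by positivity)
    hsum.summable, hsum.tsum_eq, ENNReal.ofReal_one]

/-- A compact group acting on a nonzero Hilbert space has an invariant state `S S†`. -/
theorem exists_invariant_state (V : UnitaryRep G K) (φ : K) (hφ : ‖φ‖ = 1) :
    ∃ S : K →L[ℂ] K, hsNormSq S = 1 ∧
      ∀ g y, ‖adjoint S (star (V.toHom g : K →L[ℂ] K) y)‖ = ‖adjoint S y‖ := by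
  let : MeasurableSpace G := borel G
  have : BorelSpace G := ⟨rfl⟩
  let μ : Measure G := Measure.haarMeasure ⊤
  have : IsProbabilityMeasure μ := ⟨by
    simpa using Measure.haarMeasure_self (K₀ := (⊤ : TopologicalSpace.PositiveCompacts G))⟩
  obtain ⟨S, hS, hSy⟩ := exists_hilbertSchmidt_integral μ (V.continuous_apply φ)
    fun g => (V.norm_apply g φ).trans hφ
  refine ⟨S, hS, fun g y => ?_⟩
  rw [← sq_eq_sq₀ (norm_nonneg _) (norm_nonneg _), hSy, hSy]
  simp only [← unitary_inner_right, ← V.mul_apply]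
  -- Moving `V(g)` across the inner product replaces `h` by `g * h`, which left invariance absorbs.
  exact integral_mul_left_eq_self (fun h => ‖⟪y, (V.toHom h : K →L[ℂ] K) φ⟫_ℂ‖ ^ 2) g

end Haar

/-! ### From a positive definite function to a covariant channel -/

section Backward

universe u
variable {G : Type u} [Group G] [TopologicalSpace G]
  {H K : Type*} [NormedAddCommGroup H] [InnerProductSpace ℂ H] [CompleteSpace H]
  [NormedAddCommGroup K] [InnerProductSpace ℂ K] [CompleteSpace K]

/-- The orbit of a vector under a unitary representation. -/
abbrev UnitaryRep.orbit (U : UnitaryRep G H) (ψ : H) (g : G) : H := (U.toHom g : H →L[ℂ] H) ψ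

theorem UnitaryRep.apply_mem_closedSpan (U : UnitaryRep G H) (ψ : H) (g : G) {x : H}
    (hx : x ∈ closedSpan (U.orbit ψ)) : (U.toHom g : H →L[ℂ] H) x ∈ closedSpan (U.orbit ψ) := by
  refine closedSpan_induction (p := fun x => (U.toHom g : H →L[ℂ] H) x ∈ closedSpan (U.orbit ψ))
    ((Submodule.isClosed_topologicalClosure _).preimage
      (U.toHom g : H →L[ℂ] H).continuous) (fun c => ?_) hx
  rw [Finsupp.linearCombination_apply, Finsupp.sum, map_sum]
  refine sum_mem fun h _ => ?_
  rw [map_smul, UnitaryRep.orbit, ← U.mul_apply]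
  exact Submodule.smul_mem _ _ (mem_closedSpan (U.orbit ψ) (g * h))

theorem UnitaryRep.star_apply (U : UnitaryRep G H) (g : G) (x : H) :
    star (U.toHom g : H →L[ℂ] H) x = (U.toHom g⁻¹ : H →L[ℂ] H) x := by
  rw [map_inv]
  rfl

/-- The closed span of the orbit is stable under `g` and `g⁻¹`, so its complement is stable too. -/
theorem UnitaryRep.starProjection_apply (U : UnitaryRep G H) (ψ : H) (g : G) (x : H) :
    (closedSpan (U.orbit ψ)).starProjection ((U.toHom g : H →L[ℂ] H) x) =
      (U.toHom g : H →L[ℂ] H) ((closedSpan (U.orbit ψ)).starProjection x) := by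
  refine Submodule.eq_starProjection_of_mem_of_inner_eq_zero
    (U.apply_mem_closedSpan ψ g (Submodule.starProjection_apply_mem _ x)) fun w hw => ?_
  rw [← map_sub, ← inner_conj_symm, unitary_inner_right, U.star_apply, inner_conj_symm]
  exact Submodule.starProjection_inner_eq_zero _ _ (U.apply_mem_closedSpan ψ g⁻¹ hw)

theorem hasSum_eq_of_forall_eq {J : Type*} {F F' : J → ℂ} {a b : ℂ} (h : HasSum F a)
    (h' : HasSum F' b) (e : ∀ j, F j = F' j) : a = b := by
  rw [funext e] at h
  exact h.unique h'

/-- The Kraus operators on the cyclic subspace generated by `ψ`. -/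
theorem exists_cyclic_kraus (U : UnitaryRep G H) (V : UnitaryRep G K) (ψ : H) (φ : K)
    (hφ : ‖φ‖ = 1) {f : G → ℂ} (hf : IsPositiveDefinite f) (hf1 : f 1 = 1)
    (hχ : ∀ g, charFn U ψ g = charFn V φ g * f g) :
    ∃ (J : Type u) (W : J → H →L[ℂ] K),
      (∀ x, ∑' j, ENNReal.ofReal (‖W j x‖ ^ 2) =
        ENNReal.ofReal (‖(closedSpan (U.orbit ψ)).starProjection x‖ ^ 2)) ∧
      (∀ g x y, ∑' j, ENNReal.ofReal (‖⟪y, W j ((U.toHom g : H →L[ℂ] H) x)⟫_ℂ‖ ^ 2) =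
        ∑' j, ENNReal.ofReal (‖⟪star (V.toHom g : K →L[ℂ] K) y, W j x⟫_ℂ‖ ^ 2)) ∧
      ∀ y, ∑' j, ENNReal.ofReal (‖⟪y, W j ψ⟫_ℂ‖ ^ 2) = ENNReal.ofReal (‖⟪y, φ⟫_ℂ‖ ^ 2) := by
  obtain ⟨J, m, hm⟩ := hf.exists_features
  have hms : ∀ g, HasSum (fun j => ‖m j g‖ ^ 2) 1 := by
    intro g
    have h := (hm g g).mapL Complex.reCLM
    rw [inv_mul_cancel, hf1] at h
    simpa [← Complex.normSq_eq_conj_mul_self, Complex.normSq_eq_norm_sq, ← Complex.ofReal_pow]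
      using h
  -- These vectors have Gram entries `f(g⁻¹h) χ_φ(g⁻¹h) = χ_ψ(g⁻¹h)`, the same as the orbit of `ψ`.
  let b : G → lp (fun _ : J => K) 2 := fun g => ⟨fun j => m j g • V.orbit φ g, by
    refine memlp_two_iff.2 ?_
    simpa [norm_smul, mul_pow, V.norm_apply, hφ] using (hms g).summable⟩
  have hb : ∀ g j, b g j = m j g • V.orbit φ g := fun _ _ => rfl
  obtain ⟨A, hA, hAn⟩ := exists_partialIsometry (a := U.orbit ψ) (b := b) (by
    intro g h
    rw [U.inner_apply_apply, hχ, ← V.inner_apply_apply]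
    refine hasSum_eq_of_forall_eq ((hm g h).mul_left _)
      (lp.hasSum_inner (𝕜 := ℂ) (b g) (b h)) fun j => ?_
    rw [hb, hb, inner_smul_left, inner_smul_right, Complex.star_def]
    ring)
  -- Each sum in the covariance identity is the squared norm of a vector linear in `x`, so the
  -- identity on the cyclic subspace reduces to Gram entries on the orbit.
  have hC : ∀ x y, ∑' j, ENNReal.ofReal (‖⟪y, A x j⟫_ℂ‖ ^ 2) =
      ENNReal.ofReal (‖lpInner J y (A x)‖ ^ 2) := fun x y => lp_tsum_norm_sq (lpInner J y (A x))
  have hAP : ∀ x, A x = A ((closedSpan (U.orbit ψ)).starProjection x) := by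
    intro x
    rw [← sub_eq_zero, ← map_sub, ← norm_eq_zero, hAn, map_sub,
      Submodule.starProjection_eq_self_iff.2 (Submodule.starProjection_apply_mem _ x), sub_self,
      norm_zero]
  refine ⟨J, fun j => lp.evalCLM ℂ (fun _ : J => K) 2 j ∘L A, fun x => ?_, fun g x y => ?_,
    fun y => ?_⟩
  · rw [← hAn, ← lp_tsum_norm_sq]
    rfl
  · change ∑' j, ENNReal.ofReal (‖⟪y, A _ j⟫_ℂ‖ ^ 2) = ∑' j, ENNReal.ofReal (‖⟪_, A _ j⟫_ℂ‖ ^ 2)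
    rw [hC, hC, hAP, U.starProjection_apply, hAP x]
    have h := norm_apply_eq_of_gram_eq (a := U.orbit ψ)
      (A := lpInner J y ∘L A ∘L (U.toHom g : H →L[ℂ] H))
      (B := lpInner J (star (V.toHom g : K →L[ℂ] K) y) ∘L A) (fun h k => ?_)
      (Submodule.starProjection_apply_mem (closedSpan (U.orbit ψ)) x)
    · simp only [comp_apply] at h
      rw [h]
    · have e1 : ∀ h, A ((U.toHom g : H →L[ℂ] H) (U.orbit ψ h)) = b (g * h) := fun h => by
        rw [← hA, UnitaryRep.orbit, UnitaryRep.orbit, U.mul_apply]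
      have e2 : ∀ h, ⟪star (V.toHom g : K →L[ℂ] K) y, V.orbit φ h⟫_ℂ = ⟪y, V.orbit φ (g * h)⟫_ℂ :=
        fun h => by rw [← unitary_inner_right, ← V.mul_apply]
      simp only [comp_apply, e1, hA]
      have h1 := lp.hasSum_inner (𝕜 := ℂ) (lpInner J y (b (g * h))) (lpInner J y (b (g * k)))
      have h2 := lp.hasSum_inner (𝕜 := ℂ) (lpInner J (star (V.toHom g : K →L[ℂ] K) y) (b h))
        (lpInner J (star (V.toHom g : K →L[ℂ] K) y) (b k))
      simp only [lpInner_apply, hb, inner_smul_right, RCLike.inner_apply, map_mul, e2] at h1 h2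
      -- Both Gram entries equal this factor times `f(h⁻¹k)`, since `(gh)⁻¹(gk) = h⁻¹k`.
      have h3 := (hm (g * h) (g * k)).mul_left
        (⟪y, V.orbit φ (g * k)⟫_ℂ * (starRingEnd ℂ) ⟪y, V.orbit φ (g * h)⟫_ℂ)
      have h4 := (hm h k).mul_left
        (⟪y, V.orbit φ (g * k)⟫_ℂ * (starRingEnd ℂ) ⟪y, V.orbit φ (g * h)⟫_ℂ)
      rw [show (g * h)⁻¹ * (g * k) = h⁻¹ * k by group] at h3
      refine (hasSum_eq_of_forall_eq h1 h3 fun j => ?_).trans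
        (hasSum_eq_of_forall_eq h4 h2 fun j => ?_)
      · rw [Complex.star_def]
        ring
      · rw [Complex.star_def]
        ring
  · have e : ∀ j, ‖⟪y, A ψ j⟫_ℂ‖ ^ 2 = ‖⟪y, φ⟫_ℂ‖ ^ 2 * ‖m j 1‖ ^ 2 := fun j => by
      have h1 : A ψ = b 1 := by rw [← hA, UnitaryRep.orbit, U.one_apply]
      rw [h1, hb, UnitaryRep.orbit, V.one_apply, inner_smul_right, norm_mul, mul_pow, mul_comm]
    change ∑' j, ENNReal.ofReal (‖⟪y, A ψ j⟫_ℂ‖ ^ 2) = _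
    have hs := (hms 1).mul_left (‖⟪y, φ⟫_ℂ‖ ^ 2)
    simp only [e]
    rw [← ENNReal.ofReal_tsum_of_nonneg (fun _ => by positivity) hs.summable, hs.tsum_eq, mul_one]

theorem tsum_sum_type {α β : Type*} (F : α ⊕ β → ENNReal) :
    ∑' i, F i = ∑' a, F (Sum.inl a) + ∑' b, F (Sum.inr b) :=
  Summable.tsum_sum ENNReal.summable ENNReal.summable

theorem tsum_mul_prod {α β : Type*} (F : α → ENNReal) (F' : β → ENNReal) :
    ∑' p : α × β, F p.1 * F' p.2 = (∑' a, F a) * ∑' b, F' b := by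
  rw [ENNReal.tsum_prod (f := fun a b => F a * F' b)]
  simp only [ENNReal.tsum_mul_left, ENNReal.tsum_mul_right]

theorem covariantlyConvertible_of_isPositiveDefinite [IsTopologicalGroup G] [CompactSpace G]
    (U : UnitaryRep G H) (V : UnitaryRep G K) (ψ : H) (hψ : ‖ψ‖ = 1) (φ : K) (hφ : ‖φ‖ = 1)
    {f : G → ℂ} (hf : IsPositiveDefinite f) (hχ : ∀ g, charFn U ψ g = charFn V φ g * f g) :
    CovariantlyConvertible U V (pureState ψ) (pureState φ) := by
  have hf1 : f 1 = 1 := by simpa [charFn_one U hψ, charFn_one V hφ] using (hχ 1).symm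
  obtain ⟨J, W, hW, hWcov, hWψ⟩ := exists_cyclic_kraus U V ψ φ hφ hf hf1 hχ
  obtain ⟨S, hS, hSinv⟩ := exists_invariant_state V φ hφ
  let M : Submodule ℂ H := closedSpan (U.orbit ψ)
  let Q : H →L[ℂ] H := Mᗮ.starProjection
  have hQ : ∀ x, Q x = x - M.starProjection x := fun x => Submodule.starProjection_orthogonal_val x
  have hQn : ∀ x, ‖M.starProjection x‖ ^ 2 + ‖Q x‖ ^ 2 = ‖x‖ ^ 2 := fun x =>
    (Submodule.norm_sq_eq_add_norm_sq_starProjection x M).symm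
  have hQU : ∀ g x, ‖Q ((U.toHom g : H →L[ℂ] H) x)‖ = ‖Q x‖ := fun g x => by
    rw [hQ, hQ, U.starProjection_apply, ← map_sub, U.norm_apply]
  have hQψ : Q ψ = 0 := by
    have : ψ ∈ M := by simpa [UnitaryRep.orbit, U.one_apply] using mem_closedSpan (U.orbit ψ) 1
    rw [hQ, Submodule.starProjection_eq_self_iff.2 this, sub_self]
  -- The added operators `|S eₖ⟩⟨Q eᵢ|` realize `T ↦ tr(Q T Q) S S†`, which resets the complement of
  -- the cyclic subspace to the invariant state.
  let W' : J ⊕ (basisIndex H × basisIndex K) → H →L[ℂ] K :=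
    Sum.elim W fun p => rankOne ℂ (S (onb K p.2)) (Q (onb H p.1))
  have hcoef : ∀ x, ∑' i, ENNReal.ofReal (‖⟪Q (onb H i), x⟫_ℂ‖ ^ 2) =
      ENNReal.ofReal (‖Q x‖ ^ 2) := fun x => by
    rw [← tsum_enorm_sq (onb H)]
    exact tsum_congr fun i => by
      rw [Submodule.inner_starProjection_left_eq_right]
  have hinr : ∀ x, ∑' p : basisIndex H × basisIndex K, ENNReal.ofReal (‖W' (Sum.inr p) x‖ ^ 2) =
      ENNReal.ofReal (‖Q x‖ ^ 2) := by
    intro x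
    have e : ∀ p, ENNReal.ofReal (‖W' (Sum.inr p) x‖ ^ 2) =
        ENNReal.ofReal (‖⟪Q (onb H p.1), x⟫_ℂ‖ ^ 2) *
          ENNReal.ofReal (‖S (onb K p.2)‖ ^ 2) := fun p => by
      rw [← ENNReal.ofReal_mul (by positivity), ← mul_pow, ← norm_smul]
      rfl
    simp only [e]
    rw [tsum_mul_prod (fun i => ENNReal.ofReal (‖⟪Q (onb H i), x⟫_ℂ‖ ^ 2))
      (fun k => ENNReal.ofReal (‖S (onb K k)‖ ^ 2)), hcoef, ← hsNormSq, hS, mul_one]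
  have hinr2 : ∀ x y, ∑' p : basisIndex H × basisIndex K,
      ENNReal.ofReal (‖⟪y, W' (Sum.inr p) x⟫_ℂ‖ ^ 2) =
      ENNReal.ofReal (‖Q x‖ ^ 2) * ENNReal.ofReal (‖adjoint S y‖ ^ 2) := by
    intro x y
    have e : ∀ p, ENNReal.ofReal (‖⟪y, W' (Sum.inr p) x⟫_ℂ‖ ^ 2) =
        ENNReal.ofReal (‖⟪Q (onb H p.1), x⟫_ℂ‖ ^ 2) *
          ENNReal.ofReal (‖⟪onb K p.2, adjoint S y⟫_ℂ‖ ^ 2) := fun p => by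
      rw [← ENNReal.ofReal_mul (by positivity), ← mul_pow, adjoint_inner_right,
        norm_inner_symm (S _) y, ← norm_mul, ← inner_smul_right]
      rfl
    simp only [e]
    rw [tsum_mul_prod (fun i => ENNReal.ofReal (‖⟪Q (onb H i), x⟫_ℂ‖ ^ 2))
      (fun k => ENNReal.ofReal (‖⟪onb K k, adjoint S y⟫_ℂ‖ ^ 2)), hcoef, tsum_enorm_sq]
  have hK : IsKrausFamily W' := by
    intro x
    rw [tsum_sum_type, hinr]
    change ∑' j, ENNReal.ofReal (‖W j x‖ ^ 2) + _ = _
    rw [hW, ← ENNReal.ofReal_add (by positivity) (by positivity), hQn]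
  refine ⟨hK.channel, hK.isQuantumChannel, hK.isCovariant U V fun g x y => ?_,
    hK.channel_pureState fun y => ?_⟩
  -- The added part factors as `‖Q x‖² ‖S† y‖²`; the first factor is unchanged by `U(g)`, the second
  -- by `V(g)†`.
  · rw [tsum_sum_type, tsum_sum_type, hinr2, hinr2, hQU, hSinv]
    congr 1
    exact hWcov g x y
  · rw [tsum_sum_type, hinr2, hQψ]
    rw [norm_zero, zero_pow two_ne_zero, ENNReal.ofReal_zero, zero_mul, add_zero]
    exact hWψ y

end Backward

end CovariantConversion

end

theorem theorem4 {G : Type*} [Group G] [TopologicalSpace G] [IsTopologicalGroup G]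
    [CompactSpace G] [T2Space G]
    {H K : Type*} [NormedAddCommGroup H] [InnerProductSpace ℂ H] [CompleteSpace H]
    [NormedAddCommGroup K] [InnerProductSpace ℂ K] [CompleteSpace K]
    (U : CovariantConversion.UnitaryRep G H) (V : CovariantConversion.UnitaryRep G K)
    (ψ : H) (hψ : ‖ψ‖ = 1) (φ : K) (hφ : ‖φ‖ = 1) :
    CovariantConversion.CovariantlyConvertible U V
        (CovariantConversion.pureState ψ) (CovariantConversion.pureState φ) ↔
      ∃ f : G → ℂ, CovariantConversion.IsPositiveDefinite f ∧
        ∀ g : G, CovariantConversion.charFn U ψ g = CovariantConversion.charFn V φ g * f g :=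
  ⟨CovariantConversion.exists_isPositiveDefinite_of_covariantlyConvertible U V ψ φ hφ,
    fun ⟨_, hf, hχ⟩ =>
      CovariantConversion.covariantlyConvertible_of_isPositiveDefinite U V ψ hψ φ hφ hf hχ⟩
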